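/- Work with formal power series in $q$ with integer coefficients. For power series $a,b$ with $b$ of zero constant term put $(a;b)_\infty=\prod_{n\ge 0}(1-ab^n)$. Let $$\psi(q)=\sum_{n=0}^{\infty}q^{n(n+1)/2},\qquad A(q)=\frac{(q^2;q^2)_\infty\,(q^3;q^3)_\infty^2}{(q;q)_\infty\,(q^6;q^6)_\infty},$$ and define $\mathrm{pod}_{-3}(n)$ (the number of partition triples of $n$ in which the odd parts of each partition are distinct) by the generating function $$\sum_{n=0}^{\infty}\mathrm{pod}_{-3}(n)\,q^n=\frac{(-q;q^2)_\infty^3}{(q^2;q^2)_\infty^3}.$$ For two power series with integer coefficients, $F\equiv G\pmod 9$ means that for every $n\ge 0$ the coefficients of $q^n$ in $F$ and in $G$ are congruent modulo $9$. **Theorem.** We have $$\sum_{n=0}^{\infty}(-1)^n\,\mathrm{pod}_{-3}(3n)\,q^n\equiv\frac{\psi(q^3)}{\psi(q)^4}\pmod 9,$$ $$\sum_{n=0}^{\infty}(-1)^n\,\mathrm{pod}_{-3}(3n+1)\,q^n\equiv 3\,\psi(q)\,A(q)^2\pmod 9,$$ $$\sum_{n=0}^{\infty}(-1)^n\,\mathrm{pod}_{-3}(3n+2)\,q^n\equiv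 -3\,\psi(q^3)\,\psi(q)\,A(q)\pmod 9.$$ -/

import Mathlib

noncomputable section

namespace PodTriples

open PowerSeries

section Products

/-! Formal power series over `ℤ` in the variable `q = X`.  Infinite sums and products converge
coefficientwise, that is, in the product topology with `ℤ` discrete. -/

open scoped PowerSeries.WithPiTopology

/-- The `q`-shifted factorial `(a; b)_∞ = ∏_{n ≥ 0} (1 - a b^n)` for formal power series `a`, `b`.
It is used only for `b` with constant term `0`, where the product converges. -/
def qPoch (a b : ℤ⟦X⟧) : ℤ⟦X⟧ := ∏' n : ℕ, (1 - a * b ^ n)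

/-- Ramanujan's theta function `ψ(q) = ∑_{n ≥ 0} q^{n(n+1)/2}`. -/
def psi : ℤ⟦X⟧ := ∑' n : ℕ, (X : ℤ⟦X⟧) ^ (n * (n + 1) / 2)

theorem tendsto_order_of_le (f : ℕ → ℤ⟦X⟧) (h : ∀ n : ℕ, (n : ℕ∞) ≤ (f n).order) :
    Filter.Tendsto (fun n ↦ (f n).order) Filter.atTop (nhds ⊤) := by
  refine ENat.tendsto_nhds_top_iff_natCast_lt.mpr fun m ↦ Filter.eventually_atTop.mpr ⟨m + 1, ?_⟩
  intro n hn
  refine lt_of_lt_of_le ?_ (h n)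
  exact_mod_cast hn

theorem le_order_pow (b : ℤ⟦X⟧) (hb : constantCoeff b = 0) (n : ℕ) :
    (n : ℕ∞) ≤ (b ^ n).order := by
  have h1 : (X : ℤ⟦X⟧) ∣ b := X_dvd_iff.mpr hb
  exact le_order _ _ fun i hi ↦ X_pow_dvd_iff.mp (pow_dvd_pow_of_dvd h1 n) i (by exact_mod_cast hi)

/-- The product defining `(a; b)_∞` converges when `b` has constant term `0`. -/
theorem multipliable_qPoch (a b : ℤ⟦X⟧) (hb : constantCoeff b = 0) :
    Multipliable fun n : ℕ ↦ (1 - a * b ^ n) := by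
  have := WithPiTopology.multipliable_one_add_of_tendsto_order_atTop_nhds_top ℤ
    (f := fun n : ℕ ↦ -(a * b ^ n)) (tendsto_order_of_le _ fun n ↦ by
      rw [order_neg]
      exact (le_order_pow b hb n).trans (le_add_self.trans (le_order_mul _ _)))
  simpa [sub_eq_add_neg] using this

theorem constantCoeff_qPoch (a b : ℤ⟦X⟧) (ha : constantCoeff a = 0) (hb : constantCoeff b = 0) :
    constantCoeff (qPoch a b) = 1 := by
  rw [qPoch, (multipliable_qPoch a b hb).map_tprod constantCoeff
    (WithPiTopology.continuous_constantCoeff ℤ)]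
  simp [ha]

/-- `(a; b)_∞` is invertible when `a` and `b` have constant term `0`. -/
theorem isUnit_qPoch (a b : ℤ⟦X⟧) (ha : constantCoeff a = 0) (hb : constantCoeff b = 0) :
    IsUnit (qPoch a b) := by
  rw [isUnit_iff_constantCoeff, constantCoeff_qPoch a b ha hb]
  exact isUnit_one

/-- The series defining `ψ` converges. -/
theorem summable_psi : Summable fun n : ℕ ↦ (X : ℤ⟦X⟧) ^ (n * (n + 1) / 2) := by
  refine WithPiTopology.summable_of_tendsto_order_atTop_nhds_top ℤ (tendsto_order_of_le _ fun n ↦ ?_)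
  rw [order_X_pow]
  have : n ≤ n * (n + 1) / 2 := by
    rw [Nat.le_div_iff_mul_le two_pos]
    rcases Nat.eq_zero_or_pos n with rfl | h
    · simp
    · exact Nat.mul_le_mul_left n (by omega)
  exact_mod_cast this

theorem constantCoeff_psi : constantCoeff psi = 1 := by
  rw [psi, summable_psi.map_tsum constantCoeff (WithPiTopology.continuous_constantCoeff ℤ)]
  rw [tsum_eq_single 0]
  · simp
  · intro n hn
    have : n * (n + 1) / 2 ≠ 0 := by
      have h : 2 ≤ n * (n + 1) := by nlinarith [Nat.pos_of_ne_zero hn]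
      omega
    simp [this]

/-- `ψ` is invertible. -/
theorem isUnit_psi : IsUnit psi := by
  rw [isUnit_iff_constantCoeff, constantCoeff_psi]
  exact isUnit_one

end Products

/-- `A(q) = (q²; q²)_∞ (q³; q³)_∞² / ((q; q)_∞ (q⁶; q⁶)_∞)`.  The denominator is invertible
in `ℤ⟦X⟧` by `isUnit_qPoch`, so `Ring.inverse` is its inverse. -/
def serA : ℤ⟦X⟧ :=
  qPoch (X ^ 2) (X ^ 2) * qPoch (X ^ 3) (X ^ 3) ^ 2 *
    Ring.inverse (qPoch X X * qPoch (X ^ 6) (X ^ 6))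

/-- `pod_{-k}(n)`, the coefficient of `q^n` in `(-q; q²)_∞^k / (q²; q²)_∞^k`.  The denominator is
invertible in `ℤ⟦X⟧` by `isUnit_qPoch`. -/
def podNeg (k n : ℕ) : ℤ :=
  coeff n (qPoch (-X) (X ^ 2) ^ k * Ring.inverse (qPoch (X ^ 2) (X ^ 2) ^ k))

/-- Coefficientwise congruence of integer power series modulo `m`. -/
def SeriesModEq (m : ℤ) (f g : ℤ⟦X⟧) : Prop := ∀ n : ℕ, coeff n f ≡ coeff n g [ZMOD m]

end PodTriples

end

noncomputable section

namespace PodTriples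

open PowerSeries Filter Topology
open scoped PowerSeries.WithPiTopology

/-! ### Infinite products -/

/-! Replacing `q` by `-q` turns the generating function into `1/ψ(q)³`, by Gauss's product for `ψ`
(`signedPod_mul_psi_pow`). The triple product gives `ψ(q) = A(q³) + q ψ(q⁹)` (`psi_dissection`).
Write `a = A(q)`, `b = ψ(q³)`, `c = a³ + q b³`. Since `x³ + y³ = (x + y)(x² - xy + y²)`, the series
`c(q³)³/ψ³` is the cube of a quadratic form in `A(q³)` and `q ψ(q⁹)`, and its expansion gives each
residue class modulo 3 exactly (`serA_cube_add_pow_mul_residuePart`).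

Modulo 9 the three numerators become `c²`, `-3a²bc` and `-3ab²c`, to be divided by `c³`. The first
class is then `1/c`, and `c b = ψ⁴` (`serA_cube_add_mul`), an identity obtained from the norm of `ψ`
over the cube roots of unity. In the other two, `b/c²` is needed only modulo 3, where `b ≡ ψ³` and
hence `c ≡ ψ` and `b/c² ≡ ψ` (`three_dvd_psi_mul_sq_sub`). -/

theorem _root_.Multipliable.tprod_eq_prod_tprod_residues {M : Type*} [CommMonoid M]
    [TopologicalSpace M] [ContinuousMul M] [T2Space M] {f : ℕ → M} (m : ℕ) (hm : 0 < m)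
    (hf : Multipliable f) (h : ∀ i < m, Multipliable fun n ↦ f (m * n + i)) :
    ∏' n, f n = ∏ i ∈ Finset.range m, ∏' n, f (m * n + i) := by
  have h1 : Tendsto (fun N ↦ ∏ i ∈ Finset.range m, ∏ n ∈ Finset.range N, f (m * n + i)) atTop
      (𝓝 (∏ i ∈ Finset.range m, ∏' n, f (m * n + i))) :=
    tendsto_finsetProd _ fun i hi ↦ (h i (Finset.mem_range.mp hi)).tendsto_prod_tprod_nat
  have h2 : Tendsto (fun N ↦ ∏ n ∈ Finset.range (m * N), f n) atTop (𝓝 (∏' n, f n)) :=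
    hf.tendsto_prod_tprod_nat.comp (tendsto_id.const_mul_atTop' hm)
  refine tendsto_nhds_unique h2 (h1.congr fun N ↦ ?_)
  rw [Finset.prod_comm]
  induction N with
  | zero => simp
  | succ N ih => rw [Finset.prod_range_succ, ih, mul_add_one, Finset.prod_range_add]

theorem qPoch_eq_prod_residues (a b : ℤ⟦X⟧) (hb : constantCoeff b = 0) (m : ℕ) (hm : 0 < m) :
    qPoch a b = ∏ i ∈ Finset.range m, qPoch (a * b ^ i) (b ^ m) := by
  have hf (i n : ℕ) : 1 - a * b ^ (m * n + i) = 1 - a * b ^ i * (b ^ m) ^ n := by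
    rw [pow_add, pow_mul]; ring
  rw [qPoch, (multipliable_qPoch a b hb).tprod_eq_prod_tprod_residues m hm fun i _ ↦ ?_]
  · simp_rw [hf, qPoch]
  · simp_rw [hf]
    exact multipliable_qPoch _ _ (by simp [hb, hm.ne'])

theorem qPoch_mul_qPoch_neg (a b : ℤ⟦X⟧) (hb : constantCoeff b = 0) :
    qPoch a b * qPoch (-a) b = qPoch (a ^ 2) (b ^ 2) := by
  rw [qPoch, qPoch, qPoch, ← (multipliable_qPoch a b hb).tprod_mul (multipliable_qPoch _ b hb)]
  exact tprod_congr fun n ↦ by ring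

theorem map_qPoch {S : Type*} [CommRing S] [TopologicalSpace S] [T2Space S]
    (φ : ℤ⟦X⟧ →+* S) (hφ : Continuous φ) (a b : ℤ⟦X⟧) (hb : constantCoeff b = 0) :
    φ (qPoch a b) = ∏' n : ℕ, (1 - φ a * φ b ^ n) := by
  rw [qPoch, (multipliable_qPoch a b hb).map_tprod φ hφ]
  simp

theorem multipliable_map_qPoch {S : Type*} [CommRing S] [TopologicalSpace S]
    (φ : ℤ⟦X⟧ →+* S) (hφ : Continuous φ) (a b : ℤ⟦X⟧) (hb : constantCoeff b = 0) :
    Multipliable fun n : ℕ ↦ (1 - φ a * φ b ^ n) := by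
  simpa [Function.comp_def] using (multipliable_qPoch a b hb).map φ hφ

theorem continuous_rescale (c : ℤ) : Continuous (rescale c : ℤ⟦X⟧ →+* ℤ⟦X⟧) := by
  refine continuous_iff_continuousAt.mpr fun f ↦
    (WithPiTopology.tendsto_iff_coeff_tendsto _ _ _ _).mpr fun d ↦ ?_
  simp only [coeff_rescale]
  exact ((WithPiTopology.continuous_coeff ℤ d).tendsto f).const_mul _

theorem continuous_expand (p : ℕ) (hp : p ≠ 0) :
    Continuous ((expand p hp : ℤ⟦X⟧ →ₐ[ℤ] ℤ⟦X⟧) : ℤ⟦X⟧ →+* ℤ⟦X⟧) := by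
  refine continuous_iff_continuousAt.mpr fun f ↦
    (WithPiTopology.tendsto_iff_coeff_tendsto _ _ _ _).mpr fun d ↦ ?_
  simp only [RingHom.coe_coe, coeff_expand]
  split_ifs
  · exact (WithPiTopology.continuous_coeff ℤ _).tendsto f
  · exact tendsto_const_nhds

theorem expand_qPoch (p : ℕ) (hp : p ≠ 0) (a b : ℤ⟦X⟧) (hb : constantCoeff b = 0) :
    expand p hp (qPoch a b) = qPoch (expand p hp a) (expand p hp b) :=
  map_qPoch (expand p hp : ℤ⟦X⟧ →ₐ[ℤ] ℤ⟦X⟧).toRingHom (continuous_expand p hp) a b hb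

theorem rescale_qPoch (c : ℤ) (a b : ℤ⟦X⟧) (hb : constantCoeff b = 0) :
    rescale c (qPoch a b) = qPoch (rescale c a) (rescale c b) :=
  map_qPoch (rescale c) (continuous_rescale c) a b hb

/-! ### Gaussian binomial coefficients and the Jacobi triple product -/

/-- The finite `q`-factorial `(Q; Q)_n`. -/
def qFact (Q : ℤ⟦X⟧) (n : ℕ) : ℤ⟦X⟧ := ∏ i ∈ Finset.range n, (1 - Q ^ (i + 1))

/-- The Gaussian binomial coefficient `(Q; Q)_{a+b} / ((Q; Q)_a (Q; Q)_b)`. -/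
def qBinom (Q : ℤ⟦X⟧) (a b : ℕ) : ℤ⟦X⟧ :=
  qFact Q (a + b) * Ring.inverse (qFact Q a * qFact Q b)

theorem isUnit_qFact {Q : ℤ⟦X⟧} (hQ : constantCoeff Q = 0) (n : ℕ) : IsUnit (qFact Q n) := by
  rw [isUnit_iff_constantCoeff, qFact, map_prod]
  simp [hQ]

theorem qFact_succ (Q : ℤ⟦X⟧) (n : ℕ) : qFact Q (n + 1) = qFact Q n * (1 - Q ^ (n + 1)) :=
  Finset.prod_range_succ _ _

theorem qFact_zero (Q : ℤ⟦X⟧) : qFact Q 0 = 1 := rfl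

theorem qBinom_mul {Q : ℤ⟦X⟧} (hQ : constantCoeff Q = 0) (a b : ℕ) :
    qBinom Q a b * (qFact Q a * qFact Q b) = qFact Q (a + b) := by
  rw [qBinom, mul_assoc, Ring.inverse_mul_cancel _ ((isUnit_qFact hQ a).mul (isUnit_qFact hQ b)),
    mul_one]

theorem qBinom_zero_left {Q : ℤ⟦X⟧} (hQ : constantCoeff Q = 0) (b : ℕ) : qBinom Q 0 b = 1 := by
  refine (isUnit_qFact hQ b).mul_right_cancel ?_
  simpa [qFact_zero] using qBinom_mul hQ 0 b

theorem qBinom_zero_right {Q : ℤ⟦X⟧} (hQ : constantCoeff Q = 0) (a : ℕ) : qBinom Q a 0 = 1 := by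
  refine (isUnit_qFact hQ a).mul_right_cancel ?_
  simpa [qFact_zero] using qBinom_mul hQ a 0

theorem qBinom_succ_succ {Q : ℤ⟦X⟧} (hQ : constantCoeff Q = 0) (a b : ℕ) :
    qBinom Q (a + 1) (b + 1) = qBinom Q (a + 1) b + Q ^ (b + 1) * qBinom Q a (b + 1) := by
  refine ((isUnit_qFact hQ (a + 1)).mul (isUnit_qFact hQ (b + 1))).mul_right_cancel ?_
  have h1 := qBinom_mul hQ (a + 1) b
  have h2 := qBinom_mul hQ a (b + 1)
  rw [qBinom_mul hQ, add_mul, show a + 1 + (b + 1) = a + b + 1 + 1 by ring, qFact_succ,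
    qFact_succ Q b, qFact_succ Q a]
  rw [show a + 1 + b = a + b + 1 by ring, qFact_succ Q a] at h1
  rw [show a + (b + 1) = a + b + 1 by ring, qFact_succ Q b] at h2
  linear_combination (-(1 - Q ^ (b + 1))) * h1 - Q ^ (b + 1) * (1 - Q ^ (a + 1)) * h2

/-- The homogeneous `q`-binomial theorem. -/
theorem prod_add_mul_pow {Q : ℤ⟦X⟧} (hQ : constantCoeff Q = 0) (u v : ℤ⟦X⟧) (N : ℕ) :
    ∏ i ∈ Finset.range N, (u + v * Q ^ i) =
      ∑ p ∈ Finset.HasAntidiagonal.antidiagonal N,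
        qBinom Q p.1 p.2 * Q ^ p.1.choose 2 * v ^ p.1 * u ^ p.2 := by
  induction N with
  | zero => simp [qBinom_zero_left hQ]
  | succ N ih =>
    rw [Finset.prod_range_succ, ih]
    -- Both end terms of the antidiagonal of `N` are split off below; for `N = 0` they coincide.
    cases N with
    | zero => simp [Finset.Nat.sum_antidiagonal_succ, qBinom_zero_left hQ, qBinom_zero_right hQ]
    | succ M =>
      rw [mul_add]
      nth_rewrite 1 [Finset.Nat.sum_antidiagonal_succ]
      rw [Finset.Nat.sum_antidiagonal_succ', Finset.Nat.sum_antidiagonal_succ (n := M + 1),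
        Finset.Nat.sum_antidiagonal_succ' (n := M)]
      have key : ∀ p ∈ Finset.HasAntidiagonal.antidiagonal M,
          qBinom Q (p.1 + 1) (p.2 + 1) * Q ^ (p.1 + 1).choose 2 * v ^ (p.1 + 1) * u ^ (p.2 + 1) =
          qBinom Q (p.1 + 1) p.2 * Q ^ (p.1 + 1).choose 2 * v ^ (p.1 + 1) * u ^ p.2 * u +
          qBinom Q p.1 (p.2 + 1) * Q ^ p.1.choose 2 * v ^ p.1 * u ^ (p.2 + 1) *
            (v * Q ^ (M + 1)) := by
        intro p hp
        rw [← Finset.HasAntidiagonal.mem_antidiagonal.mp hp, qBinom_succ_succ hQ,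
          Nat.choose_succ_succ' p.1 1, Nat.choose_one_right]
        ring
      rw [Finset.sum_congr rfl key, Finset.sum_add_distrib, ← Finset.sum_mul, ← Finset.sum_mul]
      rw [qBinom_zero_left hQ, qBinom_zero_left hQ, qBinom_zero_right hQ, qBinom_zero_right hQ,
        Nat.choose_succ_succ' (M + 1) 1, Nat.choose_one_right]
      ring

theorem add_choose_two (a b : ℕ) : (a + b).choose 2 = a.choose 2 + b.choose 2 + a * b := by
  induction b with
  | zero => simp
  | succ b ih =>
    rw [← add_assoc, Nat.choose_succ_succ' (a + b) 1, Nat.choose_succ_succ' b 1, ih,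
      Nat.choose_one_right, Nat.choose_one_right]
    ring

theorem succ_choose_two (a : ℕ) : (a + 1).choose 2 = a.choose 2 + a := by
  simp [add_choose_two a 1]

theorem two_mul_succ_choose_two (a : ℕ) : 2 * (a + 1).choose 2 = a * (a + 1) := by
  induction a with
  | zero => simp
  | succ a ih => rw [succ_choose_two (a + 1), mul_add, ih]; ring

/-- With `Q = xy` and `i + d + 1 = n`, one has `Q^n + x Q^d = x Q^d (1 + y Q^i)`; reversing the
product pairs `i` with `d`. -/
theorem prod_pow_add_mul_pow (x y : ℤ⟦X⟧) (n : ℕ) :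
    ∏ i ∈ Finset.range n, ((x * y) ^ n + x * (x * y) ^ i) =
      x ^ n * (x * y) ^ n.choose 2 * ∏ i ∈ Finset.range n, (1 + y * (x * y) ^ i) := by
  have h1 : ∏ i ∈ Finset.range n, (x * (x * y) ^ i) = x ^ n * (x * y) ^ n.choose 2 := by
    rw [Finset.prod_mul_distrib, Finset.prod_const, Finset.card_range, Finset.prod_pow_eq_pow_sum,
      Finset.sum_range_id, Nat.choose_two_right]
  rw [← h1, ← Finset.prod_range_reflect, ← Finset.prod_range_reflect (fun i ↦ x * (x * y) ^ i),
    ← Finset.prod_mul_distrib]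
  refine Finset.prod_congr rfl fun i hi ↦ ?_
  obtain ⟨d, rfl⟩ := Nat.exists_eq_add_of_lt (Finset.mem_range.mp hi)
  rw [show i + d + 1 - 1 - i = d by omega]
  ring

/-- A finite form of the Jacobi triple product identity. -/
theorem finite_jacobi_triple_product {x y : ℤ⟦X⟧} (hx : x ≠ 0) (hy : y ≠ 0)
    (hQ : constantCoeff (x * y) = 0) (n : ℕ) :
    (∏ i ∈ Finset.range n, (1 + x * (x * y) ^ i)) * ∏ i ∈ Finset.range n, (1 + y * (x * y) ^ i) =
      ∑ j ∈ Finset.range (n + 1),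
        qBinom (x * y) (n + j) (n - j) * (x ^ (j + 1).choose 2 * y ^ j.choose 2) +
      ∑ j ∈ Finset.range n,
        qBinom (x * y) (n - 1 - j) (n + 1 + j) * (y ^ (j + 2).choose 2 * x ^ (j + 1).choose 2) := by
  -- This monomial clears the negative powers: after multiplication by it the left side is the
  -- `q`-binomial product with `u = (xy)^n`, `v = x` and `2n` factors.
  have hK : x ^ n * (x * y) ^ (n.choose 2 + n * n) ≠ 0 :=
    mul_ne_zero (pow_ne_zero _ hx) (pow_ne_zero _ (mul_ne_zero hx hy))
  refine mul_left_cancel₀ hK ?_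
  have h1 : x ^ n * (x * y) ^ (n.choose 2 + n * n) *
      ((∏ i ∈ Finset.range n, (1 + x * (x * y) ^ i)) *
        ∏ i ∈ Finset.range n, (1 + y * (x * y) ^ i)) =
      ∏ i ∈ Finset.range (n + n), ((x * y) ^ n + x * (x * y) ^ i) := by
    have h2 : ∏ i ∈ Finset.range n, ((x * y) ^ n + x * (x * y) ^ (n + i)) =
        (x * y) ^ (n * n) * ∏ i ∈ Finset.range n, (1 + x * (x * y) ^ i) := by
      have h3 : ∏ _i ∈ Finset.range n, (x * y) ^ n = (x * y) ^ (n * n) := by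
        rw [Finset.prod_const, Finset.card_range, pow_mul]
      rw [← h3, ← Finset.prod_mul_distrib]
      exact Finset.prod_congr rfl fun i _ ↦ by ring
    rw [Finset.prod_range_add, prod_pow_add_mul_pow, h2]
    ring
  -- The sum is cut at its centre: index `n + j` gives the first sum, index `n - 1 - j` the second.
  rw [h1, prod_add_mul_pow hQ, Finset.Nat.sum_antidiagonal_eq_sum_range_succ_mk,
    show (n + n).succ = n + (n + 1) from rfl, Finset.sum_range_add,
    ← Finset.sum_range_reflect (n := n), add_comm, mul_add, Finset.mul_sum, Finset.mul_sum]
  congr 1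
  · refine Finset.sum_congr rfl fun j hj ↦ ?_
    obtain ⟨d, rfl⟩ := Nat.exists_eq_add_of_le (Nat.lt_succ_iff.mp (Finset.mem_range.mp hj))
    rw [show j + d + (j + d) - (j + d + j) = d by omega, show j + d - j = d by omega,
      add_choose_two (j + d) j, succ_choose_two j]
    ring
  · refine Finset.sum_congr rfl fun j hj ↦ ?_
    obtain ⟨d, rfl⟩ := Nat.exists_eq_add_of_lt (Finset.mem_range.mp hj)
    rw [show j + d + 1 - 1 - j = d by omega,
      show j + d + 1 + (j + d + 1) - d = j + d + 1 + 1 + j by omega,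
      show j + d + 1 = d + (j + 1) by omega, add_choose_two d (j + 1), succ_choose_two (j + 1)]
    have h3 : d.choose 2 + (d + (j + 1)) * (d + (j + 1) + 1 + j) =
        (j + 1) + 2 * (j + 1).choose 2 + d.choose 2 + d * (j + 1) +
          (d + (j + 1)) * (d + (j + 1)) := by
      rw [two_mul_succ_choose_two]; ring
    calc _ = qBinom (x * y) d (d + (j + 1) + 1 + j) * x ^ d *
          (x * y) ^ (d.choose 2 + (d + (j + 1)) * (d + (j + 1) + 1 + j)) := by ring
      _ = _ := by rw [h3]; ring

theorem pow_dvd_qFact_sub (Q : ℤ⟦X⟧) {c n : ℕ} (h : c ≤ n) :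
    Q ^ (c + 1) ∣ qFact Q n - qFact Q c := by
  induction n, h using Nat.le_induction with
  | base => simp
  | succ n h ih =>
    rw [qFact_succ, show qFact Q n * (1 - Q ^ (n + 1)) - qFact Q c =
      (qFact Q n - qFact Q c) - qFact Q n * Q ^ (n + 1) by ring]
    exact dvd_sub ih ((pow_dvd_pow Q (by omega)).mul_left _)

/-- Modulo `Q^(c+1)` all `(Q; Q)_k` with `k ≥ c` agree with the unit `(Q; Q)_c`, so the product
reduces to 1. -/
theorem pow_dvd_qFact_mul_qBinom_sub_one {Q : ℤ⟦X⟧} (hQ : constantCoeff Q = 0) {a b c n : ℕ}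
    (ha : c ≤ a) (hb : c ≤ b) (hn : c ≤ n) :
    Q ^ (c + 1) ∣ qFact Q n * qBinom Q a b - 1 := by
  have hF := isUnit_qFact hQ c
  obtain ⟨u, hu⟩ := pow_dvd_qFact_sub Q ha
  obtain ⟨v, hv⟩ := pow_dvd_qFact_sub Q hb
  obtain ⟨w, hw⟩ := pow_dvd_qFact_sub Q hn
  obtain ⟨z, hz⟩ := pow_dvd_qFact_sub Q (ha.trans (Nat.le_add_right a b))
  have hB := qBinom_mul hQ a b
  rw [sub_eq_iff_eq_add] at hu hv hw hz
  rw [hu, hv, hz] at hB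
  have h1 : Q ^ (c + 1) ∣ qFact Q c * (qFact Q c * qBinom Q a b - 1) := by
    refine ⟨z - qBinom Q a b * (u * (Q ^ (c + 1) * v + qFact Q c) + qFact Q c * v), ?_⟩
    linear_combination hB
  rw [hF.dvd_mul_left] at h1
  rw [hw, show (Q ^ (c + 1) * w + qFact Q c) * qBinom Q a b - 1 =
    Q ^ (c + 1) * (w * qBinom Q a b) + (qFact Q c * qBinom Q a b - 1) by ring]
  exact dvd_add (dvd_mul_right _ _) h1

theorem eq_of_tendsto_of_X_pow_dvd_sub {f g : ℕ → ℤ⟦X⟧} {a b : ℤ⟦X⟧} (hf : Tendsto f atTop (𝓝 a))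
    (hg : Tendsto g atTop (𝓝 b)) (h : ∀ n, X ^ n ∣ f n - g n) : a = b := by
  have h0 : Tendsto (fun n ↦ f n - g n) atTop (𝓝 0) := by
    refine (WithPiTopology.tendsto_iff_coeff_tendsto _ _ _ _).mpr fun d ↦ ?_
    refine tendsto_const_nhds.congr' (eventually_atTop.mpr ⟨d + 1, fun n hn ↦ ?_⟩)
    exact (map_zero _).trans (X_pow_dvd_iff.mp (h n) d (by omega)).symm
  exact sub_eq_zero.mp (tendsto_nhds_unique (hf.sub hg) h0)

theorem summable_of_X_pow_dvd (f : ℕ → ℤ⟦X⟧) (h : ∀ n, X ^ n ∣ f n) : Summable f :=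
  WithPiTopology.summable_of_tendsto_order_atTop_nhds_top ℤ (tendsto_order_of_le _ fun n ↦
    le_order _ _ fun i hi ↦ X_pow_dvd_iff.mp (h n) i (by exact_mod_cast hi))

theorem le_succ_choose_two (j : ℕ) : j ≤ (j + 1).choose 2 := by
  rw [succ_choose_two]; exact Nat.le_add_left _ _

theorem X_pow_dvd_pow {x : ℤ⟦X⟧} (hx : X ∣ x) {n m : ℕ} (h : n ≤ m) : X ^ n ∣ x ^ m :=
  (pow_dvd_pow X h).trans (pow_dvd_pow_of_dvd hx m)

theorem summable_theta_nonneg {x : ℤ⟦X⟧} (hx : X ∣ x) (y : ℤ⟦X⟧) :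
    Summable fun j : ℕ ↦ x ^ (j + 1).choose 2 * y ^ j.choose 2 :=
  summable_of_X_pow_dvd _ fun j ↦ (X_pow_dvd_pow hx (le_succ_choose_two j)).mul_right _

theorem summable_theta_neg {x : ℤ⟦X⟧} (hx : X ∣ x) (y : ℤ⟦X⟧) :
    Summable fun j : ℕ ↦ y ^ (j + 2).choose 2 * x ^ (j + 1).choose 2 :=
  summable_of_X_pow_dvd _ fun j ↦ (X_pow_dvd_pow hx (le_succ_choose_two j)).mul_left _

/-- The Jacobi triple product identity. -/
theorem jacobi_triple_product {x y : ℤ⟦X⟧} (hx : X ∣ x) (hx0 : x ≠ 0) (hy0 : y ≠ 0) :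
    qPoch (-x) (x * y) * qPoch (-y) (x * y) * qPoch (x * y) (x * y) =
      ∑' j : ℕ, x ^ (j + 1).choose 2 * y ^ j.choose 2 +
      ∑' j : ℕ, y ^ (j + 2).choose 2 * x ^ (j + 1).choose 2 := by
  have hQ : constantCoeff (x * y) = 0 := X_dvd_iff.mp (hx.mul_right y)
  have hXQ : X ∣ x * y := hx.mul_right y
  refine eq_of_tendsto_of_X_pow_dvd_sub
    (((multipliable_qPoch (-x) _ hQ).tendsto_prod_tprod_nat.mul
      (multipliable_qPoch (-y) _ hQ).tendsto_prod_tprod_nat).mul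
      (multipliable_qPoch (x * y) _ hQ).tendsto_prod_tprod_nat)
    (((tendsto_add_atTop_iff_nat 1).mpr (summable_theta_nonneg hx y).hasSum.tendsto_sum_nat).add
      (summable_theta_neg hx y).hasSum.tendsto_sum_nat) fun n ↦ ?_
  have hF : ∏ i ∈ Finset.range n, (1 - x * y * (x * y) ^ i) = qFact (x * y) n :=
    Finset.prod_congr rfl fun i _ ↦ by ring
  simp only [neg_mul, sub_neg_eq_add]
  rw [hF, finite_jacobi_triple_product hx0 hy0 hQ, add_mul, add_sub_add_comm, Finset.sum_mul,
    Finset.sum_mul, ← Finset.sum_sub_distrib, ← Finset.sum_sub_distrib]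
  -- The `j`-th error is small for two reasons: the coefficient is 1 up to order `n - j`, and the
  -- theta term is divisible by `X^j` through `x` alone.
  refine dvd_add (Finset.dvd_sum fun j hj ↦ ?_) (Finset.dvd_sum fun j hj ↦ ?_)
  · have hj' := Finset.mem_range.mp hj
    have h1 := (X_pow_dvd_pow hXQ le_rfl).trans (pow_dvd_qFact_mul_qBinom_sub_one hQ
      (a := n + j) (b := n - j) (c := n - j) (n := n) (by omega) le_rfl (by omega))
    have h2 := mul_dvd_mul h1
      ((X_pow_dvd_pow hx (le_succ_choose_two j)).mul_right (y ^ j.choose 2))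
    rw [← pow_add] at h2
    refine ((pow_dvd_pow X (by omega)).trans h2).trans (dvd_of_eq (by ring))
  · have hj' := Finset.mem_range.mp hj
    have h1 := (X_pow_dvd_pow hXQ le_rfl).trans (pow_dvd_qFact_mul_qBinom_sub_one hQ
      (a := n - 1 - j) (b := n + 1 + j) (c := n - 1 - j) (n := n) le_rfl (by omega) (by omega))
    have h2 := mul_dvd_mul h1
      ((X_pow_dvd_pow hx (le_succ_choose_two j)).mul_left (y ^ (j + 2).choose 2))
    rw [← pow_add] at h2
    refine ((pow_dvd_pow X (by omega)).trans h2).trans (dvd_of_eq (by ring))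

/-! ### Product formulas for `ψ` and `A` -/

theorem tsum_eq_sum_residues {f : ℕ → ℤ⟦X⟧} (hf : Summable f) (m : ℕ) (hm : 0 < m) :
    ∑' n, f n = ∑ i ∈ Finset.range m, ∑' n, f (m * n + i) := by
  have h (i : ℕ) : Summable fun n ↦ f (m * n + i) :=
    hf.comp_injective fun a b hab ↦ Nat.eq_of_mul_eq_mul_left hm (by simpa using hab)
  have h1 : Tendsto (fun N ↦ ∑ i ∈ Finset.range m, ∑ n ∈ Finset.range N, f (m * n + i)) atTop
      (𝓝 (∑ i ∈ Finset.range m, ∑' n, f (m * n + i))) :=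
    tendsto_finsetSum _ fun i _ ↦ (h i).hasSum.tendsto_sum_nat
  have h2 : Tendsto (fun N ↦ ∑ n ∈ Finset.range (m * N), f n) atTop (𝓝 (∑' n, f n)) :=
    hf.hasSum.tendsto_sum_nat.comp (tendsto_id.const_mul_atTop' hm)
  refine tendsto_nhds_unique h2 (h1.congr fun N ↦ ?_)
  rw [Finset.sum_comm]
  induction N with
  | zero => simp
  | succ N ih => rw [Finset.sum_range_succ, ih, mul_add_one, Finset.sum_range_add]

theorem triangular_eq (n : ℕ) : n * (n + 1) / 2 = (n + 1).choose 2 := by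
  rw [Nat.choose_two_right, Nat.add_sub_cancel, mul_comm]

/-- Triple product at `x = q³`, `y = q`: triangular numbers of even index form its first sum, those
of odd index its second. -/
theorem psi_eq_jacobi :
    psi = qPoch (-X ^ 3) (X ^ 4) * qPoch (-X) (X ^ 4) * qPoch (X ^ 4) (X ^ 4) := by
  have h := jacobi_triple_product (x := X ^ 3) (y := X) (dvd_pow_self _ (by decide))
    (pow_ne_zero _ X_ne_zero) X_ne_zero
  rw [← pow_succ] at h
  rw [h, psi, tsum_eq_sum_residues summable_psi 2 two_pos, Finset.sum_range_succ,
    Finset.sum_range_one]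
  congr 1 <;> refine tsum_congr fun j ↦ ?_ <;> rw [triangular_eq, ← pow_mul, ← pow_add] <;>
    congr 1
  · have := two_mul_succ_choose_two (2 * j + 0)
    have := two_mul_succ_choose_two j
    have := succ_choose_two j
    nlinarith
  · have := two_mul_succ_choose_two (2 * j + 1)
    have := two_mul_succ_choose_two j
    have := succ_choose_two (j + 1)
    nlinarith

theorem psi_eq : psi = qPoch (-X) (X ^ 2) * qPoch (X ^ 4) (X ^ 4) := by
  rw [psi_eq_jacobi, qPoch_eq_prod_residues (-X) (X ^ 2) (by simp) 2 two_pos,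
    Finset.prod_range_succ, Finset.prod_range_one]
  ring_nf

/-- Gauss's product for `ψ`. -/
theorem psi_mul_qPoch_odd : psi * qPoch X (X ^ 2) = qPoch (X ^ 2) (X ^ 2) := by
  have h := qPoch_mul_qPoch_neg X (X ^ 2) (by simp)
  rw [psi_eq, qPoch_eq_prod_residues (X ^ 2) (X ^ 2) (by simp) 2 two_pos,
    Finset.prod_range_succ, Finset.prod_range_one]
  rw [pow_zero, mul_one, pow_one, ← pow_mul, ← pow_add]
  rw [← pow_mul] at h
  norm_num at h ⊢
  rw [← h]
  ring

theorem psi_mul_qPoch_X : psi * qPoch X X = qPoch (X ^ 2) (X ^ 2) ^ 2 := by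
  rw [qPoch_eq_prod_residues X X (by simp) 2 two_pos, Finset.prod_range_succ,
    Finset.prod_range_one, pow_zero, mul_one, pow_one, ← pow_two, ← mul_assoc, psi_mul_qPoch_odd,
    ← pow_two]

theorem serA_mul :
    serA * (qPoch X X * qPoch (X ^ 6) (X ^ 6)) =
      qPoch (X ^ 2) (X ^ 2) * qPoch (X ^ 3) (X ^ 3) ^ 2 := by
  rw [serA, mul_assoc, Ring.inverse_mul_cancel, mul_one]
  exact (isUnit_qPoch _ _ (by simp) (by simp)).mul (isUnit_qPoch _ _ (by simp) (by simp))

/-- Since `(-q; q)_∞ = (q²; q²)_∞/(q; q)_∞`, and likewise in `q³`, splitting `(-q; q)_∞` modulo 3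
cancels the factor `(-q³; q³)_∞`. -/
theorem serA_eq_jacobi :
    serA = qPoch (-X ^ 2) (X ^ 3) * qPoch (-X) (X ^ 3) * qPoch (X ^ 3) (X ^ 3) := by
  have h1 := qPoch_mul_qPoch_neg X X (by simp)
  have h3 := qPoch_mul_qPoch_neg (X ^ 3) (X ^ 3) (by simp)
  rw [← pow_mul] at h3
  have h := qPoch_eq_prod_residues (-X) X (by simp) 3 three_pos
  rw [Finset.prod_range_succ, Finset.prod_range_succ, Finset.prod_range_one, pow_zero, mul_one,
    pow_one, neg_mul, neg_mul, ← pow_two, ← pow_succ'] at h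
  norm_num at h h3
  have hu : IsUnit (qPoch X X * qPoch (X ^ 6) (X ^ 6)) :=
    (isUnit_qPoch _ _ (by simp) (by simp)).mul (isUnit_qPoch _ _ (by simp) (by simp))
  refine hu.mul_right_cancel ?_
  rw [serA_mul, ← h1, ← h3, h]
  ring

theorem serA_eq_tsum : serA =
    ∑' j : ℕ, (X ^ 2) ^ (j + 1).choose 2 * X ^ j.choose 2 +
      ∑' j : ℕ, X ^ (j + 2).choose 2 * (X ^ 2) ^ (j + 1).choose 2 := by
  rw [← jacobi_triple_product (dvd_pow_self _ two_ne_zero) (pow_ne_zero _ X_ne_zero) X_ne_zero,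
    serA_eq_jacobi, ← pow_succ]

theorem expand_tsum (p : ℕ) (hp : p ≠ 0) {f : ℕ → ℤ⟦X⟧} (hf : Summable f) :
    expand p hp (∑' n, f n) = ∑' n, expand p hp (f n) :=
  hf.map_tsum (expand p hp : ℤ⟦X⟧ →ₐ[ℤ] ℤ⟦X⟧).toRingHom (continuous_expand p hp)

/-- The 3-dissection of `ψ`. -/
theorem psi_dissection : psi =
    expand 3 three_ne_zero serA + X * expand 3 three_ne_zero (expand 3 three_ne_zero psi) := by
  rw [serA_eq_tsum, map_add, expand_tsum _ _ (summable_theta_nonneg (dvd_pow_self _ two_ne_zero) X),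
    expand_tsum _ _ (summable_theta_neg (dvd_pow_self _ two_ne_zero) X)]
  nth_rewrite 1 [psi]
  have h1 : X * expand 3 three_ne_zero (expand 3 three_ne_zero psi) =
      ∑' n : ℕ, (X : ℤ⟦X⟧) ^ (9 * (n * (n + 1) / 2) + 1) := by
    rw [← expand_mul, psi, expand_tsum _ _ summable_psi, ← Summable.tsum_mul_left]
    · exact tsum_congr fun n ↦ by rw [map_pow, expand_X, ← pow_mul, pow_succ']
    · exact summable_psi.map (expand (3 * 3) _ : ℤ⟦X⟧ →ₐ[ℤ] ℤ⟦X⟧).toRingHom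
        (continuous_expand (3 * 3) (by decide))
  -- Indices `3j` and `3j + 2` give the two halves of `A(q³)`; index `3j + 1` gives exponent `9
  -- j(j+1)/2 + 1`.
  rw [h1, tsum_eq_sum_residues summable_psi 3 three_pos, Finset.sum_range_succ,
    Finset.sum_range_succ, Finset.sum_range_one, add_right_comm]
  simp only [map_pow, expand_X, ← pow_mul, ← pow_add]
  congr 1
  · congr 1 <;> refine tsum_congr fun j ↦ ?_ <;> rw [triangular_eq] <;> congr 1
    · have := two_mul_succ_choose_two (3 * j + 0)
      have := two_mul_succ_choose_two j
      have := succ_choose_two j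
      nlinarith
    · have := two_mul_succ_choose_two (3 * j + 2)
      have := two_mul_succ_choose_two j
      have := succ_choose_two (j + 1)
      nlinarith
  · refine tsum_congr fun j ↦ ?_
    rw [triangular_eq, triangular_eq]
    congr 1
    have := two_mul_succ_choose_two (3 * j + 1)
    have := two_mul_succ_choose_two j
    nlinarith

/-! ### The norm over cube roots of unity -/

/-- The substitution `q ↦ ζ q`, with values in complex power series. -/
def twist (ζ : ℂ) : ℤ⟦X⟧ →+* ℂ⟦X⟧ := (rescale ζ).comp (map (Int.castRingHom ℂ))

theorem coeff_twist (ζ : ℂ) (f : ℤ⟦X⟧) (n : ℕ) : coeff n (twist ζ f) = ζ ^ n * ((coeff n f : ℤ) : ℂ) := by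
  simp [twist, coeff_rescale]

theorem twist_X (ζ : ℂ) : twist ζ X = C ζ * X := by
  simp [twist, rescale_X]

theorem twist_injective : Function.Injective (twist 1) := fun f g h ↦ by
  ext n
  have := congrArg (coeff n) h
  simpa [coeff_twist] using this

theorem continuous_twist (ζ : ℂ) : Continuous (twist ζ) := by
  refine continuous_iff_continuousAt.mpr fun f ↦
    (WithPiTopology.tendsto_iff_coeff_tendsto _ _ _ _).mpr fun d ↦ ?_
  simp only [coeff_twist]
  exact ((continuous_of_discreteTopology (f := fun z : ℤ ↦ (z : ℂ))).tendsto _).comp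
    ((WithPiTopology.continuous_coeff ℤ d).tendsto f) |>.const_mul _

theorem twist_expand {ζ : ℂ} (hζ : ζ ^ 3 = 1) (f : ℤ⟦X⟧) :
    twist ζ (expand 3 three_ne_zero f) = twist 1 (expand 3 three_ne_zero f) := by
  ext n
  rw [coeff_twist, coeff_twist, coeff_expand]
  split_ifs with h
  · obtain ⟨k, rfl⟩ := h
    rw [pow_mul, hζ, one_pow, one_pow]
  · simp

theorem twist_qPoch_X_pow (ζ : ℂ) (m : ℕ) (hm : 0 < m) :
    twist ζ (qPoch (X ^ m) (X ^ m)) = ∏' n : ℕ, (1 - C (ζ ^ (m * (n + 1))) * X ^ (m * (n + 1))) := by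
  rw [map_qPoch _ (continuous_twist ζ) _ _ (by simp [hm.ne'])]
  refine tprod_congr fun n ↦ ?_
  rw [map_pow, twist_X, ← pow_succ', ← pow_mul, mul_pow, ← map_pow]

theorem multipliable_twist (ζ : ℂ) (m : ℕ) (hm : 0 < m) :
    Multipliable fun n : ℕ ↦ (1 - C (ζ ^ (m * (n + 1))) * X ^ (m * (n + 1)) : ℂ⟦X⟧) := by
  refine (multipliable_map_qPoch _ (continuous_twist ζ) (X ^ m) (X ^ m) (by simp [hm.ne'])).congr
    fun n ↦ ?_
  rw [map_pow, twist_X, ← pow_succ', ← pow_mul, mul_pow, ← map_pow]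

/-- Padding with ones puts `(q^(3m); q^(3m))_∞` on the index set of `(q^m; q^m)_∞`, so that products
can be compared factor by factor. -/
theorem hasProd_ite_three_dvd (m : ℕ) (hm : 0 < m) :
    HasProd (fun n : ℕ ↦ if 3 ∣ n + 1 then (1 - X ^ (m * (n + 1)) : ℂ⟦X⟧) else 1)
      (twist 1 (qPoch (X ^ (3 * m)) (X ^ (3 * m)))) := by
  have hg : Function.Injective fun n : ℕ ↦ 3 * n + 2 := fun a b h ↦ by simpa using h
  rw [← hg.hasProd_iff]
  · have h := (multipliable_twist 1 (3 * m) (by positivity)).hasProd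
    rw [← twist_qPoch_X_pow 1 (3 * m) (by positivity)] at h
    refine h.congr_fun ?_
    intro n
    simp [show 3 ∣ 3 * n + 2 + 1 from ⟨n + 1, by ring⟩]
    ring_nf
  · intro n hn
    rw [if_neg]
    rintro ⟨k, hk⟩
    exact hn ⟨k - 1, by simp only; omega⟩

theorem prod_cube_roots {ω : ℂ} (hω : ω ^ 2 + ω + 1 = 0) {k : ℕ} (hk : ¬ 3 ∣ k) (Y : ℂ⟦X⟧) :
    (1 - Y) * (1 - C (ω ^ k) * Y) * (1 - C ((ω ^ 2) ^ k) * Y) = 1 - Y ^ 3 := by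
  have h3 : ω ^ 3 = 1 := by linear_combination (ω - 1) * hω
  have key (a b : ℂ) (h1 : a + b = -1) (h2 : a * b = 1) :
      (1 - Y) * (1 - C a * Y) * (1 - C b * Y) = 1 - Y ^ 3 := by
    have h1' : (C a + C b : ℂ⟦X⟧) = -1 := by rw [← map_add, h1]; simp
    have h2' : (C a * C b : ℂ⟦X⟧) = 1 := by rw [← map_mul, h2]; simp
    linear_combination (-Y * (1 - Y)) * h1' + (Y ^ 2 * (1 - Y)) * h2'
  obtain ⟨d, hd⟩ : ∃ d, k = 3 * d + 1 ∨ k = 3 * d + 2 := ⟨k / 3, by omega⟩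
  have h3d : ω ^ (3 * d) = 1 := by rw [pow_mul, h3, one_pow]
  rcases hd with rfl | rfl
  · have ha : ω ^ (3 * d + 1) = ω := by rw [pow_add, h3d, one_mul, pow_one]
    rw [pow_right_comm, ha]
    exact key _ _ (by linear_combination hω) (by linear_combination h3)
  · have ha : ω ^ (3 * d + 2) = ω ^ 2 := by rw [pow_add, h3d, one_mul]
    rw [pow_right_comm, ha]
    exact key _ _ (by linear_combination hω + ω * h3) (by linear_combination (ω ^ 3 + 1) * h3)

/-- At a factor with `3 ∣ n + 1` the three twists coincide; otherwise `3 ∤ m` makes them multiply to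
`1 - q^(3m(n+1))`. -/
theorem norm_qPoch {ω : ℂ} (hω : ω ^ 2 + ω + 1 = 0) (m : ℕ) (hm : ¬ 3 ∣ m) :
    twist 1 (qPoch (X ^ m) (X ^ m)) * twist ω (qPoch (X ^ m) (X ^ m)) *
      twist (ω ^ 2) (qPoch (X ^ m) (X ^ m)) * twist 1 (qPoch (X ^ (9 * m)) (X ^ (9 * m))) =
    twist 1 (qPoch (X ^ (3 * m)) (X ^ (3 * m))) ^ 4 := by
  have h3 : ω ^ 3 = 1 := by linear_combination (ω - 1) * hω
  have hm0 : 0 < m := Nat.pos_of_ne_zero fun h ↦ hm (h ▸ dvd_zero 3)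
  have hP (ζ : ℂ) (m : ℕ) (hm : 0 < m) := by
    have h := (multipliable_twist ζ m hm).hasProd
    rw [← twist_qPoch_X_pow ζ m hm] at h
    exact h
  have hL := (((hP 1 m hm0).mul (hP ω m hm0)).mul (hP (ω ^ 2) m hm0)).mul
    (hasProd_ite_three_dvd (3 * m) (by positivity))
  have hI := hasProd_ite_three_dvd m hm0
  have hR := (((hP 1 (3 * m) (by positivity)).mul hI).mul hI).mul hI
  rw [show 9 * m = 3 * (3 * m) by ring, hL.unique (hR.congr_fun ?_)]
  · ring
  · intro n
    by_cases hn : 3 ∣ n + 1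
    · obtain ⟨k, hk⟩ := hn
      simp only [hk, dvd_mul_right, if_true]
      rw [show ω ^ (m * (3 * k)) = (ω ^ 3) ^ (m * k) by ring,
        show (ω ^ 2) ^ (m * (3 * k)) = (ω ^ 3) ^ (2 * m * k) by ring, h3]
      simp
      ring
    · simp only [hn, if_false, one_pow, map_one, one_mul, mul_one]
      rw [prod_cube_roots hω (Nat.prime_three.prime.not_dvd_mul hm hn)]
      ring

theorem exists_cube_root : ∃ ω : ℂ, ω ^ 2 + ω + 1 = 0 := by
  have h := (Complex.isPrimitiveRoot_exp 3 three_ne_zero).geom_sum_eq_zero (by norm_num)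
  rw [Finset.sum_range_succ, Finset.sum_range_succ, Finset.sum_range_one] at h
  exact ⟨_, by linear_combination h⟩

theorem expand_three_qPoch_X_pow (m : ℕ) (hm : 0 < m) :
    expand 3 three_ne_zero (qPoch (X ^ m) (X ^ m)) = qPoch (X ^ (3 * m)) (X ^ (3 * m)) := by
  rw [expand_qPoch _ _ _ _ (by simp [hm.ne']), map_pow, expand_X, ← pow_mul]

theorem expand_psi_mul :
    expand 3 three_ne_zero psi * qPoch (X ^ 3) (X ^ 3) = qPoch (X ^ 6) (X ^ 6) ^ 2 := by
  have h := congrArg (expand 3 three_ne_zero) psi_mul_qPoch_X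
  have h1 := expand_three_qPoch_X_pow 1 one_pos
  rw [pow_one] at h1
  rwa [map_mul, map_pow, h1, expand_three_qPoch_X_pow 2 two_pos] at h

theorem expand_expand_psi_mul :
    expand 3 three_ne_zero (expand 3 three_ne_zero psi) * qPoch (X ^ 9) (X ^ 9) =
      qPoch (X ^ 18) (X ^ 18) ^ 2 := by
  have h := congrArg (expand 3 three_ne_zero) expand_psi_mul
  rwa [map_mul, map_pow, expand_three_qPoch_X_pow 3 three_pos,
    expand_three_qPoch_X_pow 6 (by norm_num)] at h

theorem expand_injective : Function.Injective (expand 3 three_ne_zero : ℤ⟦X⟧ → ℤ⟦X⟧) :=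
  fun f g h ↦ by
  ext n
  rw [← coeff_expand_mul 3 three_ne_zero f n, h, coeff_expand_mul]

theorem twist_psi {ζ : ℂ} (hζ : ζ ^ 3 = 1) :
    twist ζ psi = twist 1 (expand 3 three_ne_zero serA) +
      C ζ * (X * twist 1 (expand 3 three_ne_zero (expand 3 three_ne_zero psi))) := by
  conv_lhs => rw [psi_dissection]
  rw [map_add, map_mul, twist_expand hζ, twist_expand hζ, twist_X, mul_assoc]

/-- The norm of `ψ` is computed twice: from the 3-dissection it is `A(q³)³ + q³ ψ(q⁹)³`, and from `ψ
= (q²; q²)_∞²/(q; q)_∞` with `norm_qPoch` it is `ψ(q³)⁴/ψ(q⁹)`. Injectivity of `q ↦ q³` then gives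
the claim. -/
theorem serA_cube_add_mul :
    (serA ^ 3 + X * expand 3 three_ne_zero psi ^ 3) * expand 3 three_ne_zero psi = psi ^ 4 := by
  obtain ⟨ω, hω⟩ := exists_cube_root
  have h3 : ω ^ 3 = 1 := by linear_combination (ω - 1) * hω
  have hC : (C ω ^ 2 + C ω + 1 : ℂ⟦X⟧) = 0 := by
    rw [← map_pow, ← map_add, ← map_one C, ← map_add, hω, map_zero]
  refine expand_injective (twist_injective ?_)
  have p0 := twist_psi (ζ := 1) (one_pow 3)
  have p1 := twist_psi h3
  have p2 := twist_psi (ζ := ω ^ 2) (by rw [pow_right_comm, h3, one_pow])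
  have q (ζ : ℂ) := congrArg (twist ζ) psi_mul_qPoch_X
  simp only [map_mul, map_pow] at q
  have n1 := norm_qPoch hω 1 (by norm_num)
  have n2 := norm_qPoch hω 2 (by norm_num)
  have e3 := congrArg (twist 1) expand_psi_mul
  have e9 := congrArg (twist 1) expand_expand_psi_mul
  have q0 := q 1
  have q1 := q ω
  have q2 := q (ω ^ 2)
  rw [p0] at q0
  rw [p1] at q1
  rw [p2] at q2
  have hu (m : ℕ) (hm : 0 < m) : IsUnit (twist 1 (qPoch (X ^ m) (X ^ m))) :=
    (isUnit_qPoch _ _ (by simp [hm.ne']) (by simp [hm.ne'])).map (twist 1)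
  have hu3 := hu 3 three_pos
  have hu18 := hu 18 (by norm_num)
  have hX : twist 1 (X ^ 3) = X ^ 3 := by rw [map_pow, twist_X, map_one, one_mul]
  norm_num only [map_mul, map_pow, map_add, expand_X, map_one, pow_one, one_mul] at *
  rw [twist_X, map_one, one_mul] at *
  generalize twist 1 (expand 3 three_ne_zero (expand 3 three_ne_zero psi)) = y at *
  generalize twist 1 (expand 3 three_ne_zero psi) = z at *
  generalize twist 1 (expand 3 three_ne_zero serA) = a at *
  -- These are the denominators of the product formula for the norm.
  refine (((hu3.pow 4).mul (hu18.pow 2))).mul_right_cancel ?_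
  have hN : (a + X * y) * (a + C ω * (X * y)) * (a + C ω ^ 2 * (X * y)) = a ^ 3 + X ^ 3 * y ^ 3 := by
    linear_combination (a + X * y) * (a * (X * y) + (C ω - 1) * (X * y) ^ 2) * hC
  have hM := congrArg₂ (· * ·) (congrArg₂ (· * ·) q0 q1) q2
  rw [← hN]
  generalize twist 1 (qPoch (X ^ 18) (X ^ 18)) = F18 at *
  generalize twist 1 (qPoch (X ^ 3) (X ^ 3)) = F3 at *
  generalize twist 1 (qPoch (X ^ 9) (X ^ 9)) = F9 at *
  generalize twist 1 (qPoch (X ^ 6) (X ^ 6)) = F6 at *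
  calc _ = (a + X * y) * (a + C ω * (X * y)) * (a + C ω ^ 2 * (X * y)) * y * F18 ^ 2 * F3 ^ 4 := by
        ring
    _ = (twist 1 (qPoch (X ^ 2) (X ^ 2)) * twist ω (qPoch (X ^ 2) (X ^ 2)) *
          twist (ω ^ 2) (qPoch (X ^ 2) (X ^ 2)) * F18) ^ 2 * (y * F9) := by
        rw [← n1]; linear_combination y * F18 ^ 2 * F9 * hM
    _ = (F6 ^ 2) ^ 4 * F18 ^ 2 := by rw [n2, e9]; ring
    _ = _ := by rw [← e3]; ring

/-! ### Congruences -/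

theorem C_dvd_of_map_zmod_eq_zero (p : ℕ) {f : ℤ⟦X⟧} (h : map (Int.castRingHom (ZMod p)) f = 0) :
    (C (p : ℤ) : ℤ⟦X⟧) ∣ f := by
  have hd (n : ℕ) : (p : ℤ) ∣ coeff n f := by
    rw [← ZMod.intCast_zmod_eq_zero_iff_dvd]
    simpa using congrArg (coeff n) h
  choose g hg using hd
  exact ⟨mk g, by ext n; rw [coeff_C_mul, coeff_mk, hg]⟩

/-- Frobenius: over `ZMod p` it fixes the coefficients, so the `p`-th power only replaces `q` by
`q^p`. -/
theorem C_dvd_expand_sub_pow (p : ℕ) [hp : Fact p.Prime] (f : ℤ⟦X⟧) :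
    (C (p : ℤ) : ℤ⟦X⟧) ∣ expand p hp.out.ne_zero f - f ^ p := by
  refine C_dvd_of_map_zmod_eq_zero p ?_
  rw [map_sub, map_pow, map_expand, sub_eq_zero]
  have h := MvPowerSeries.map_frobenius_expand p hp.out.ne_zero
    (f := map (Int.castRingHom (ZMod p)) f)
  rw [ZMod.frobenius_zmod, MvPowerSeries.map_id] at h
  exact h

theorem seriesModEq_of_dvd {m : ℤ} {f g : ℤ⟦X⟧} (h : C m ∣ g - f) : SeriesModEq m f g := by
  obtain ⟨k, hk⟩ := h
  refine fun n ↦ Int.modEq_iff_dvd.mpr ⟨coeff n k, ?_⟩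
  rw [← map_sub, hk, coeff_C_mul]

/-! ### Residue classes of exponents modulo 3 -/

/-- The part of a power series supported on exponents `3 n + i`, as a series in `q ^ 3`. -/
def residuePart (i : ℕ) (f : ℤ⟦X⟧) : ℤ⟦X⟧ := mk fun n ↦ coeff (3 * n + i) f

theorem residuePart_add (i : ℕ) (f g : ℤ⟦X⟧) :
    residuePart i (f + g) = residuePart i f + residuePart i g := by
  ext n; simp [residuePart]

theorem residuePart_X_pow_mul_expand {i j : ℕ} (hi : i < 3) (hj : j < 3) (f : ℤ⟦X⟧) :
    residuePart i (X ^ j * expand 3 three_ne_zero f) = if i = j then f else 0 := by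
  ext n
  rw [residuePart, coeff_mk, coeff_X_pow_mul', coeff_expand]
  split_ifs with h1 h2 h3 h3 h4
  · subst h3; congr 2; omega
  · omega
  · omega
  · simp
  · omega
  · simp

theorem eq_sum_residuePart (f : ℤ⟦X⟧) :
    f = X ^ 0 * expand 3 three_ne_zero (residuePart 0 f) +
      X ^ 1 * expand 3 three_ne_zero (residuePart 1 f) +
      X ^ 2 * expand 3 three_ne_zero (residuePart 2 f) := by
  ext n
  simp only [map_add, coeff_X_pow_mul', coeff_expand, residuePart, coeff_mk]
  obtain ⟨k, rfl | rfl | rfl⟩ : ∃ k, n = 3 * k ∨ n = 3 * k + 1 ∨ n = 3 * k + 2 :=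
    ⟨n / 3, by omega⟩ <;>
  split_ifs <;>
  first
  | omega
  | simp only [add_zero, zero_add]
    exact congrArg (fun i ↦ coeff i f) (by omega)

theorem residuePart_expand_mul {i : ℕ} (hi : i < 3) (f g : ℤ⟦X⟧) :
    residuePart i (expand 3 three_ne_zero f * g) = f * residuePart i g := by
  conv_lhs => rw [eq_sum_residuePart g]
  rw [mul_add, mul_add, mul_left_comm, mul_left_comm _ (X ^ 1), mul_left_comm _ (X ^ 2), ← map_mul,
    ← map_mul, ← map_mul, residuePart_add, residuePart_add,
    residuePart_X_pow_mul_expand hi three_pos, residuePart_X_pow_mul_expand hi (by decide),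
    residuePart_X_pow_mul_expand hi (by decide)]
  interval_cases i <;> simp

/-- The series `∑ (-1)^n pod_{-3}(n) q^n`. -/
def signedPod : ℤ⟦X⟧ := mk fun n ↦ (-1) ^ n * podNeg 3 n

theorem signedPod_mul_psi_pow : signedPod * psi ^ 3 = 1 := by
  have hu : IsUnit (qPoch (X ^ 2) (X ^ 2) ^ 3) := (isUnit_qPoch _ _ (by simp) (by simp)).pow 3
  have h1 : signedPod = rescale (-1)
      (qPoch (-X) (X ^ 2) ^ 3 * Ring.inverse (qPoch (X ^ 2) (X ^ 2) ^ 3)) := by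
    ext n
    rw [coeff_rescale, signedPod, coeff_mk, podNeg]
  have hX : rescale (-1 : ℤ) X = -X := by simp [rescale_X]
  have h2 : signedPod * qPoch (X ^ 2) (X ^ 2) ^ 3 = qPoch X (X ^ 2) ^ 3 := by
    have h3 : rescale (-1 : ℤ) (qPoch (X ^ 2) (X ^ 2)) = qPoch (X ^ 2) (X ^ 2) := by
      rw [rescale_qPoch _ _ _ (by simp), map_pow, hX, neg_sq]
    have h4 : rescale (-1 : ℤ) (qPoch (-X) (X ^ 2)) = qPoch X (X ^ 2) := by
      rw [rescale_qPoch _ _ _ (by simp), map_pow, map_neg, hX, neg_sq, neg_neg]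
    nth_rewrite 1 [← h3]
    rw [h1, ← map_pow, ← map_mul, mul_assoc, Ring.inverse_mul_cancel _ hu, mul_one, map_pow, h4]
  refine ((isUnit_qPoch X (X ^ 2) (by simp) (by simp)).pow 3).mul_right_cancel ?_
  rw [mul_assoc, ← mul_pow, psi_mul_qPoch_odd, h2, one_mul]

/-- The right sides are the three components of `(x² - xy + y²)³` for `x = A(q³)`, `y = q ψ(q⁹)`,
sorted by the power of `q` modulo 3. -/
theorem serA_cube_add_pow_mul_residuePart {i : ℕ} (hi : i < 3) :
    (serA ^ 3 + X * expand 3 three_ne_zero psi ^ 3) ^ 3 * residuePart i signedPod =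
      if i = 0 then serA ^ 6 - 7 * X * serA ^ 3 * expand 3 three_ne_zero psi ^ 3 +
        X ^ 2 * expand 3 three_ne_zero psi ^ 6
      else if i = 1 then -3 * serA ^ 5 * expand 3 three_ne_zero psi +
        6 * X * serA ^ 2 * expand 3 three_ne_zero psi ^ 4
      else 6 * serA ^ 4 * expand 3 three_ne_zero psi ^ 2 -
        3 * X * serA * expand 3 three_ne_zero psi ^ 5 := by
  rw [← residuePart_expand_mul hi]
  have h : expand 3 three_ne_zero ((serA ^ 3 + X * expand 3 three_ne_zero psi ^ 3) ^ 3) *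
      signedPod =
      X ^ 0 * expand 3 three_ne_zero (serA ^ 6 - 7 * X * serA ^ 3 * expand 3 three_ne_zero psi ^ 3 +
        X ^ 2 * expand 3 three_ne_zero psi ^ 6) +
      X ^ 1 * expand 3 three_ne_zero (-3 * serA ^ 5 * expand 3 three_ne_zero psi +
        6 * X * serA ^ 2 * expand 3 three_ne_zero psi ^ 4) +
      X ^ 2 * expand 3 three_ne_zero (6 * serA ^ 4 * expand 3 three_ne_zero psi ^ 2 -
        3 * X * serA * expand 3 three_ne_zero psi ^ 5) := by
    refine (isUnit_psi.pow 3).mul_right_cancel ?_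
    rw [mul_assoc, signedPod_mul_psi_pow, congrArg (· ^ 3) psi_dissection]
    simp only [map_add, map_sub, map_mul, map_pow, map_neg, map_ofNat, expand_X]
    ring
  rw [h, residuePart_add, residuePart_add, residuePart_X_pow_mul_expand hi three_pos,
    residuePart_X_pow_mul_expand hi (by decide), residuePart_X_pow_mul_expand hi (by decide)]
  interval_cases i <;> simp

/-! ### Reduction modulo 9 -/

theorem isUnit_serA_cube_add : IsUnit (serA ^ 3 + X * expand 3 three_ne_zero psi ^ 3) :=
  isUnit_of_mul_isUnit_left (serA_cube_add_mul ▸ isUnit_psi.pow 4)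

theorem three_dvd_psi_mul_sq_sub :
    (3 : ℤ⟦X⟧) ∣ psi * (serA ^ 3 + X * expand 3 three_ne_zero psi ^ 3) ^ 2 -
      expand 3 three_ne_zero psi := by
  obtain ⟨d, hd⟩ := haveI : Fact (Nat.Prime 3) := ⟨Nat.prime_three⟩
    C_dvd_expand_sub_pow 3 psi
  rw [Nat.cast_ofNat, map_ofNat] at hd
  have hu : IsUnit (expand 3 three_ne_zero psi ^ 2) :=
    (isUnit_psi.map (expand 3 three_ne_zero)).pow 2
  -- After multiplication by `b²`, the relation `c b = ψ⁴` turns the difference into `ψ⁹ - b³`, a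
  -- multiple of `ψ³ - b`.
  rw [← hu.dvd_mul_right]
  have hc := serA_cube_add_mul
  generalize serA ^ 3 + X * expand 3 three_ne_zero psi ^ 3 = c at *
  generalize expand 3 three_ne_zero psi = b at *
  exact ⟨-d * (b ^ 2 + b * psi ^ 3 + psi ^ 6), by
    linear_combination psi * (c * b + psi ^ 4) * hc - (b ^ 2 + b * psi ^ 3 + psi ^ 6) * hd⟩

theorem nine_dvd_sub_of_pow_mul {f g : ℤ⟦X⟧}
    (h : (9 : ℤ⟦X⟧) ∣ (serA ^ 3 + X * expand 3 three_ne_zero psi ^ 3) ^ 3 * g -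
      (serA ^ 3 + X * expand 3 three_ne_zero psi ^ 3) ^ 3 * f) : SeriesModEq 9 f g := by
  refine seriesModEq_of_dvd ?_
  rwa [← mul_sub, (isUnit_serA_cube_add.pow 3).dvd_mul_left, ← map_ofNat C] at h

theorem mk_podNeg_zero : (mk fun n : ℕ ↦ (-1) ^ n * podNeg 3 (3 * n)) = residuePart 0 signedPod := by
  ext n
  simp [residuePart, signedPod, pow_mul]

theorem mk_podNeg_one :
    (mk fun n : ℕ ↦ (-1) ^ n * podNeg 3 (3 * n + 1)) = -residuePart 1 signedPod := by
  ext n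
  simp [residuePart, signedPod, pow_add, pow_mul]

theorem mk_podNeg_two :
    (mk fun n : ℕ ↦ (-1) ^ n * podNeg 3 (3 * n + 2)) = residuePart 2 signedPod := by
  ext n
  simp [residuePart, signedPod, pow_add, pow_mul]

end PodTriples

end

theorem theorem2p2 :
    PodTriples.SeriesModEq 9
      (PowerSeries.mk fun n : ℕ ↦ (-1) ^ n * PodTriples.podNeg 3 (3 * n))
      (PowerSeries.expand 3 three_ne_zero PodTriples.psi * Ring.inverse (PodTriples.psi ^ 4)) ∧
    PodTriples.SeriesModEq 9
      (PowerSeries.mk fun n : ℕ ↦ (-1) ^ n * PodTriples.podNeg 3 (3 * n + 1))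
      (3 * PodTriples.psi * PodTriples.serA ^ 2) ∧
    PodTriples.SeriesModEq 9
      (PowerSeries.mk fun n : ℕ ↦ (-1) ^ n * PodTriples.podNeg 3 (3 * n + 2))
      (-3 * PowerSeries.expand 3 three_ne_zero PodTriples.psi * PodTriples.psi *
        PodTriples.serA) := by
  open PodTriples PowerSeries in
  rw [mk_podNeg_zero, mk_podNeg_one, mk_podNeg_two]
  have h0 := serA_cube_add_pow_mul_residuePart (i := 0) (by decide)
  have h1 := serA_cube_add_pow_mul_residuePart (i := 1) (by decide)
  have h2 := serA_cube_add_pow_mul_residuePart (i := 2) (by decide)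
  simp only [if_true, one_ne_zero, two_ne_zero, OfNat.ofNat_ne_one, if_false] at h0 h1 h2
  obtain ⟨k, hk⟩ := three_dvd_psi_mul_sq_sub
  have hi : (serA ^ 3 + X * expand 3 three_ne_zero psi ^ 3) *
      (expand 3 three_ne_zero psi * Ring.inverse (psi ^ 4)) = 1 := by
    rw [← mul_assoc, serA_cube_add_mul, Ring.mul_inverse_cancel _ (isUnit_psi.pow 4)]
  refine ⟨nine_dvd_sub_of_pow_mul ?_, nine_dvd_sub_of_pow_mul ?_, nine_dvd_sub_of_pow_mul ?_⟩
  -- Here `c³ · (1/c) = c²`, whose middle coefficient 2 differs from -7 by 9.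
  · rw [h0, pow_succ, mul_assoc, hi]
    exact ⟨X * serA ^ 3 * expand 3 three_ne_zero psi ^ 3, by ring⟩
  · rw [mul_neg, h1]
    -- Substituting `ψ c² = b + 3k` gives `3a²bc + 9a²ck`; the remaining multiple of 9 comes from 3
    -- against -6 in the `q a² b⁴` term.
    exact ⟨serA ^ 2 * (serA ^ 3 + X * expand 3 three_ne_zero psi ^ 3) * k +
      X * serA ^ 2 * expand 3 three_ne_zero psi ^ 4, by
        linear_combination
          3 * serA ^ 2 * (serA ^ 3 + X * expand 3 three_ne_zero psi ^ 3) * hk⟩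
  · rw [h2]
    exact ⟨-(expand 3 three_ne_zero psi * serA *
        (serA ^ 3 + X * expand 3 three_ne_zero psi ^ 3) * k) -
      serA ^ 4 * expand 3 three_ne_zero psi ^ 2, by
        linear_combination
          (-3 * expand 3 three_ne_zero psi * serA *
            (serA ^ 3 + X * expand 3 three_ne_zero psi ^ 3)) * hk⟩
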